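/- **Setting.** A CBOR item is an integer in $[-2^{64},2^{64}-1]$, a simple value in $[0,23]\cup[32,255]$, a byte string, a UTF-8 text string, a tagged item, an array of items, or a finite map from items to items (all tags, lengths and numbers of entries below $2^{64}$). CDDL types $t$, array groups $a$ and map groups $g$ are given by $$t ::= \theta \mid [a] \mid \{g\} \mid t_1/t_2,\qquad \theta ::= \bot\mid \ell\mid \mathtt{any}\mid\mathtt{int}\mid\mathtt{uint}\mid\mathtt{nint}\mid\mathtt{tstr}\mid\mathtt{bstr},$$ $$a ::= t\mid a_1/\!/a_2\mid\ ?a\mid a_1,a_2\mid *a,\qquad g ::= t_k\Rightarrow t_v\mid \ell:t\mid g_1/\!/g_2\mid\ ?g\mid g_1,g_2\mid *g,$$ with $\ell$ an integer or text literal. A type denotes the predicate "valid for $t$" on CBOR items. An array group maps a list of items to a (consumed, remaining) pair or to failure, with greedy $*$ and non-backtracking $/\!/$. A map group maps a finite map to a set of (consumed, remaining) pairs or to $\bot$, the latter when a cut fails, that is, when the key of $\ell:t$ is present with a value not valid for $t$. $[a]$ and $\{g\}$ require that everything is consumed. Item lists and maps that a group consumes entirely are called valid for it. **Elaboration** $\mathit{elab}(t)$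 is the partial function with the following steps. (a) Rewrite each $*(e_1/\!/e_2/\!/\dots)$, the $e_i$ being entries, to $*e_1,*e_2,\dots$; reject $t$ unless all map groups are then of the form $g::=\ell\Rightarrow t\mid \ell:t\mid *(t_k\Rightarrow t_v)\mid g_1/\!/g_2\mid\ ?g\mid g_1,g_2$. Call the result the canonical form of $t$. (b) In each map type $\{g\}$ replace $g$ by $g'$, where $(\bot;g)\rightsquigarrow(t';g')$ by the following rules, the first applicable one being used (and rejecting if none applies): $(t;\ell\Rightarrow t_v)\rightsquigarrow(t/\ell;\ell\Rightarrow t_v)$; $(t;\ell:t_v)\rightsquigarrow(t/\ell;\ell:t_v)$; $(t;?(\ell:t_v))\rightsquigarrow(t/\ell;?(\ell:t_v))$; if $(t/\ell;g_i)\rightsquigarrow(t_i;g_i')$ for $i=1,2$, then $(t;((\ell:t_v),g_1)/\!/g_2)\rightsquigarrow(t_1\cap t_2;((\ell:t_v),g_1')/\!/g_2')$; if $(t;g_i)\rightsquigarrow(t_i;g_i')$ for $i=1,2$, then $(t;g_1/\!/g_2)\rightsquigarrow(t_1\cap t_2;g_1'/\!/g_2')$; if $(t;g_1)\rightsquigarrow(t_1;g_1')$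 and $(t_1;g_2)\rightsquigarrow(t_2;g_2')$, then $(t;(g_1,g_2))\rightsquigarrow(t_2;(g_1',g_2'))$; $(t;*(t_k\Rightarrow t_v))\rightsquigarrow(t;*((t_k\backslash t)\Rightarrow t_v))$. Here $t_1\cap t_2$ consists of the literals that are alternatives of both, and $*((t_k\backslash t_{\rm rej})\Rightarrow t_v)$ consumes all entries whose key is valid for $t_k$ and not for $t_{\rm rej}$ and whose value is valid for $t_v$. (c) Reject unless: both sides of every $t_1/t_2$, $a_1/\!/a_2$, $g_1/\!/g_2$ are disjoint (no item, item list or map is valid for both); in every $*a_1,*a_2,a_3$ the group $a_1$ is disjoint from $a_2$ and from $a_3$, and in every other $*a_1,a_2$ the groups $a_1$ and $a_2$ are disjoint; and in every $g_1,g_2$ between map groups the footprints (all keys that appear, minus the excluded keys of tables) are disjoint. **Interpretation and parser.** $[\![t_1/t_2]\!]$ and $[\![x_1/\!/x_2]\!]$ are disjoint unions, $[\![x_1,x_2]\!]$ is a product, $[\![?x]\!]$ an option type, $[\![*a]\!]$ a list type, $[\![*(t_k\Rightarrow t_v)]\!]$ (with or without excluded keys) the type of finite associations from $[\![t_k]\!]$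 to lists over $[\![t_v]\!]$, $[\![\ell]\!]$ the unit type, $[\![\ell\Rightarrow t]\!]=[\![\ell:t]\!]=[\![\ell]\!]\times[\![t]\!]$, and the other base types have the evident interpretation. The parser specification of a type follows its structure; for $t_1/t_2$ it is $\mathsf{Inl}(p_1(x))$ if $x$ is valid for $t_1$ and $\mathsf{Inr}(p_2(x))$ otherwise. For a CDDL type, $[\![t]\!]$ and the parser specification are those of its canonical form. **Theorem.** Let $t$ be a CDDL type such that $t'=\mathit{elab}(t)$ is defined. Let $u$ be either $t$ or the elaborated type $t'$. The parser specification of $u$ is defined on every CBOR item that is valid for $u$; let $p:\{x \text{ valid for } u\}\to[\![u]\!]$ be the resulting function. Then $p$ is injective; there is $\sigma:[\![u]\!]\to\mathsf{bool}$ such that $\sigma(p(x))$ holds for every CBOR item $x$ valid for $u$; and there is a serializer $s$ from $\{y\in[\![u]\!]:\sigma(y)\}$ to the CBOR items valid for $u$ such that $p(s(y))=y$ for every $y$ with $\sigma(y)$. -/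

import Mathlib

namespace CDDL

noncomputable section

open scoped Classical

/-! ## The CBOR data model -/

/-- Raw CBOR data. Integers, lengths and tags are given by their values (so the minimal integer
representation is implicit); a text string is a `String`, that is, a valid UTF-8 byte sequence;
a map is a list of entries. -/
inductive Raw : Type
  | int (n : ℤ)
  | simple (n : ℕ)
  | bytes (b : List UInt8)
  | text (s : String)
  | tagged (tag : ℕ) (x : Raw)
  | array (xs : List Raw)
  | map (es : List (Raw × Raw))

/-- Raw data that is a CBOR item: all numbers are in range, and the entries of every map are sorted
strictly by their keys. The order is some fixed strict total order on raw data; its only role is to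
select exactly one list of entries for each finite map. -/
inductive Raw.Canonical : Raw → Prop
  | int {n : ℤ} : -2 ^ 64 ≤ n → n < 2 ^ 64 → Canonical (.int n)
  | simple {n : ℕ} : n ≤ 23 ∨ (32 ≤ n ∧ n ≤ 255) → Canonical (.simple n)
  | bytes {b : List UInt8} : b.length < 2 ^ 64 → Canonical (.bytes b)
  | text {s : String} : s.utf8ByteSize < 2 ^ 64 → Canonical (.text s)
  | tagged {tag : ℕ} {x : Raw} : tag < 2 ^ 64 → Canonical x → Canonical (.tagged tag x)
  | array {xs : List Raw} : xs.length < 2 ^ 64 → (∀ x ∈ xs, Canonical x) → Canonical (.array xs)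
  | map {es : List (Raw × Raw)} : es.length < 2 ^ 64 → (∀ e ∈ es, Canonical e.1) →
      (∀ e ∈ es, Canonical e.2) → es.Pairwise (fun e e' => WellOrderingRel e.1 e'.1) →
      Canonical (.map es)

/-- CBOR items. -/
def Cbor : Type := {r : Raw // r.Canonical}

/-- A set of map entries. A finite CBOR map is such a set without duplicate keys. -/
abbrev Entries : Type := Finset (Cbor × Cbor)

/-- No two entries have the same key. -/
def Entries.IsMap (m : Entries) : Prop :=
  ∀ e ∈ m, ∀ e' ∈ m, e.1 = e'.1 → e = e'

theorem Raw.Canonical.array_items {xs : List Raw} (h : Canonical (.array xs)) :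
    ∀ x ∈ xs, x.Canonical := by
  cases h; assumption

theorem Raw.Canonical.map_entries {es : List (Raw × Raw)} (h : Canonical (.map es)) :
    ∀ e ∈ es, e.1.Canonical ∧ e.2.Canonical := by
  cases h with
  | map _ h1 h2 _ => exact fun e he => ⟨h1 e he, h2 e he⟩

/-- The list of items of a CBOR array. -/
def Cbor.asArray : Cbor → Option (List Cbor)
  | ⟨.array xs, h⟩ => some (xs.pmap Subtype.mk h.array_items)
  | _ => none

/-- The finite map carried by a CBOR map. -/
def Cbor.asMap : Cbor → Option Entries
  | ⟨.map es, h⟩ =>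
      some (es.pmap (fun e he => ((⟨e.1, he.1⟩ : Cbor), (⟨e.2, he.2⟩ : Cbor))) h.map_entries).toFinset
  | _ => none

/-! ## Abstract syntax -/

/-- Labels: integer and text string literals. -/
inductive Label : Type
  | int (n : ℤ) (lo : -2 ^ 64 ≤ n) (hi : n < 2 ^ 64)
  | str (s : String) (hs : s.utf8ByteSize < 2 ^ 64)
  deriving DecidableEq

/-- The CBOR item denoted by a label. -/
def Label.toCbor : Label → Cbor
  | .int n lo hi => ⟨.int n, .int lo hi⟩
  | .str s hs => ⟨.text s, .text hs⟩

/-- Base types. -/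
inductive Base : Type
  | bot | lit (l : Label) | any | int | uint | nint | tstr | bstr
  deriving DecidableEq

mutual

/-- CDDL types: `θ`, `[a]`, `{g}`, `t₁ / t₂`. -/
inductive Ty : Type
  | base (b : Base)
  | array (a : AGroup)
  | map (g : MGroup)
  | alt (t₁ t₂ : Ty)

/-- CDDL array groups: `t`, `a₁ // a₂`, `?a`, `a₁, a₂`, `*a`. -/
inductive AGroup : Type
  | item (t : Ty)
  | choice (a₁ a₂ : AGroup)
  | opt (a : AGroup)
  | seq (a₁ a₂ : AGroup)
  | star (a : AGroup)

/-- CDDL map groups: `k => t`, `l : t` (with a cut), `g₁ // g₂`, `?g`, `g₁, g₂`, `*g`. -/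
inductive MGroup : Type
  | entry (k t : Ty)
  | cutEntry (l : Label) (t : Ty)
  | choice (g₁ g₂ : MGroup)
  | opt (g : MGroup)
  | seq (g₁ g₂ : MGroup)
  | star (g : MGroup)

end

mutual

/-- Types all of whose map groups are deterministic, with tables decorated by excluded keys. -/
inductive ETy : Type
  | base (b : Base)
  | array (a : EAGroup)
  | map (g : EMGroup)
  | alt (t₁ t₂ : ETy)

/-- Array groups over `ETy`. -/
inductive EAGroup : Type
  | item (t : ETy)
  | choice (a₁ a₂ : EAGroup)
  | opt (a : EAGroup)
  | seq (a₁ a₂ : EAGroup)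
  | star (a : EAGroup)

/-- Deterministic map groups:
`l => t`, `l : t`, `*((k \ rej) => t)`, `g₁ // g₂`, `?g`, `g₁, g₂`. -/
inductive EMGroup : Type
  | entry (l : Label) (t : ETy)
  | cutEntry (l : Label) (t : ETy)
  | table (k rej t : ETy)
  | choice (g₁ g₂ : EMGroup)
  | opt (g : EMGroup)
  | seq (g₁ g₂ : EMGroup)

end

/-! ## Validity semantics

Types denote predicates on CBOR items. -/

/-- The validity predicate of a base type. -/
def Base.Valid : Base → Cbor → Prop
  | .bot, _ => False
  | .lit l, x => x = l.toCbor
  | .any, _ => True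
  | .int, x => ∃ n, x.1 = .int n
  | .uint, x => ∃ n, x.1 = .int n ∧ 0 ≤ n
  | .nint, x => ∃ n, x.1 = .int n ∧ n < 0
  | .tstr, x => ∃ s, x.1 = .text s
  | .bstr, x => ∃ b, x.1 = .bytes b

/-- The meaning of an array group: from a list of items, the consumed and the remaining items, or
`none` if the group does not match. -/
abbrev ASem : Type := List Cbor → Option (List Cbor × List Cbor)

namespace ASem

def item (P : Cbor → Prop) : ASem
  | [] => none
  | x :: l => if P x then some ([x], l) else none

/-- The choice does not backtrack. -/
def choice (a₁ a₂ : ASem) : ASem := fun l =>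
  match a₁ l with
  | some r => some r
  | none => a₂ l

def opt (a : ASem) : ASem := fun l =>
  match a l with
  | some r => some r
  | none => some ([], l)

def seq (a₁ a₂ : ASem) : ASem := fun l =>
  match a₁ l with
  | none => none
  | some (c₁, r₁) =>
    match a₂ r₁ with
    | none => none
    | some (c₂, r₂) => some (c₁ ++ c₂, r₂)

/-- At most `n` greedy repetitions; an iteration that consumes nothing ends the repetition. -/
def starUpTo (a : ASem) : ℕ → ASem
  | 0, l => some ([], l)
  | n + 1, l =>
    match a l with
    | none => some ([], l)
    | some ([], _) => some ([], l)
    | some (x :: c, r) =>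
      match starUpTo a n r with
      | none => none
      | some (c', r') => some (x :: c ++ c', r')

/-- Greedy repetition: every iteration but the last consumes an item, so that the length of the
list bounds their number. -/
def star (a : ASem) : ASem := fun l => starUpTo a l.length l

/-- A list is valid for an array group if the group consumes all of it. -/
def Matches (a : ASem) (l : List Cbor) : Prop := ∃ c, a l = some (c, [])

end ASem

/-- The nondeterministic meaning of a map group: from a finite map, the set of possible
(consumed, remaining) pairs, or `none` if a cut fails. The empty set means that the group does not
match. -/
abbrev MSem : Type := Entries → Option (Set (Entries × Entries))

namespace MSem

/-- Consumption of one entry with key in `P` and value in `Q`. -/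
def entry (P Q : Cbor → Prop) : MSem := fun m =>
  some {cr | ∃ e ∈ m, P e.1 ∧ Q e.2 ∧ cr = ({e}, m.erase e)}

/-- The same with a cut: it fails if a key in `P` has a value outside of `Q`. -/
def cutEntry (P Q : Cbor → Prop) : MSem := fun m =>
  if ∃ e ∈ m, P e.1 ∧ ¬ Q e.2 then none else entry P Q m

/-- Consumption of all entries with key in `P` but not in `R` and with value in `Q`. -/
def table (P R Q : Cbor → Prop) : MSem := fun m =>
  some {(m.filter (fun e => P e.1 ∧ ¬ R e.1 ∧ Q e.2),
    m.filter (fun e => ¬ (P e.1 ∧ ¬ R e.1 ∧ Q e.2)))}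

/-- The choice does not backtrack and does not catch the failure of a cut. -/
def choice (g₁ g₂ : MSem) : MSem := fun m =>
  match g₁ m with
  | none => none
  | some S => if S = ∅ then g₂ m else some S

def opt (g : MSem) : MSem := fun m =>
  match g m with
  | none => none
  | some S => if S = ∅ then some {(∅, m)} else some S

/-- Continue every result `(c, r)` in `S` by `k c r`, adding `c` to what is consumed. A cut that
fails in one of the continuations makes the whole fail. -/
def extend (S : Set (Entries × Entries))
    (k : Entries → Entries → Option (Set (Entries × Entries))) :
    Option (Set (Entries × Entries)) :=
  if ∃ cr ∈ S, k cr.1 cr.2 = none then none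
  else some {cr | ∃ cr₁ ∈ S, ∃ T, k cr₁.1 cr₁.2 = some T ∧ ∃ cr₂ ∈ T, cr = (cr₁.1 ∪ cr₂.1, cr₂.2)}

def seq (g₁ g₂ : MSem) : MSem := fun m =>
  match g₁ m with
  | none => none
  | some S => extend S (fun _ r => g₂ r)

/-- At most `n` greedy repetitions; an iteration that consumes nothing ends the repetition. -/
def starUpTo (g : MSem) : ℕ → MSem
  | 0, m => some {(∅, m)}
  | n + 1, m =>
    match g m with
    | none => none
    | some S =>
      if S = ∅ then some {(∅, m)}
      else extend S (fun c r => if c = ∅ then some {(∅, r)} else starUpTo g n r)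

/-- Greedy repetition: every iteration but the last consumes an entry, so that the number of
entries bounds the number of iterations. -/
def star (g : MSem) : MSem := fun m => starUpTo g m.card m

/-- A map is valid for a map group if the group can consume all of it. -/
def Matches (g : MSem) (m : Entries) : Prop := ∃ S, g m = some S ∧ ∃ c, (c, ∅) ∈ S

end MSem

mutual

/-- Validity of a CBOR item with respect to a CDDL type. -/
def Ty.Valid : Ty → Cbor → Prop
  | .base b => fun x => b.Valid x
  | .array a => fun x => ∃ l, x.asArray = some l ∧ ASem.Matches a.sem l
  | .map g => fun x => ∃ m, x.asMap = some m ∧ MSem.Matches g.sem m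
  | .alt t₁ t₂ => fun x => t₁.Valid x ∨ t₂.Valid x

def AGroup.sem : AGroup → ASem
  | .item t => ASem.item t.Valid
  | .choice a₁ a₂ => ASem.choice a₁.sem a₂.sem
  | .opt a => ASem.opt a.sem
  | .seq a₁ a₂ => ASem.seq a₁.sem a₂.sem
  | .star a => ASem.star a.sem

def MGroup.sem : MGroup → MSem
  | .entry k t => MSem.entry k.Valid t.Valid
  | .cutEntry l t => MSem.cutEntry (fun x => x = l.toCbor) t.Valid
  | .choice g₁ g₂ => MSem.choice g₁.sem g₂.sem
  | .opt g => MSem.opt g.sem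
  | .seq g₁ g₂ => MSem.seq g₁.sem g₂.sem
  | .star g => MSem.star g.sem

end

mutual

/-- Validity of a CBOR item with respect to an elaborated type. -/
def ETy.Valid : ETy → Cbor → Prop
  | .base b => fun x => b.Valid x
  | .array a => fun x => ∃ l, x.asArray = some l ∧ ASem.Matches a.sem l
  | .map g => fun x => ∃ m, x.asMap = some m ∧ MSem.Matches g.sem m
  | .alt t₁ t₂ => fun x => t₁.Valid x ∨ t₂.Valid x

def EAGroup.sem : EAGroup → ASem
  | .item t => ASem.item t.Valid
  | .choice a₁ a₂ => ASem.choice a₁.sem a₂.sem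
  | .opt a => ASem.opt a.sem
  | .seq a₁ a₂ => ASem.seq a₁.sem a₂.sem
  | .star a => ASem.star a.sem

def EMGroup.sem : EMGroup → MSem
  | .entry l t => MSem.entry (fun x => x = l.toCbor) t.Valid
  | .cutEntry l t => MSem.cutEntry (fun x => x = l.toCbor) t.Valid
  | .table k rej t => MSem.table k.Valid rej.Valid t.Valid
  | .choice g₁ g₂ => MSem.choice g₁.sem g₂.sem
  | .opt g => MSem.opt g.sem
  | .seq g₁ g₂ => MSem.seq g₁.sem g₂.sem

end

/-! ## Elaboration

First step: canonical form. `*(e₁ // e₂ // …)`, where the `eᵢ` are entries, becomes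
`*e₁, *e₂, …`; a type is rejected if a map group is then not deterministic. -/

mutual

def Ty.canonical : Ty → Option ETy
  | .base b => some (.base b)
  | .array a => do return .array (← a.canonical)
  | .map g => do return .map (← g.canonical)
  | .alt t₁ t₂ => do return .alt (← t₁.canonical) (← t₂.canonical)

def AGroup.canonical : AGroup → Option EAGroup
  | .item t => do return .item (← t.canonical)
  | .choice a₁ a₂ => do return .choice (← a₁.canonical) (← a₂.canonical)
  | .opt a => do return .opt (← a.canonical)
  | .seq a₁ a₂ => do return .seq (← a₁.canonical) (← a₂.canonical)
  | .star a => do return .star (← a.canonical)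

def MGroup.canonical : MGroup → Option EMGroup
  | .entry (.base (.lit l)) t => do return .entry l (← t.canonical)
  | .entry _ _ => none
  | .cutEntry l t => do return .cutEntry l (← t.canonical)
  | .choice g₁ g₂ => do return .choice (← g₁.canonical) (← g₂.canonical)
  | .opt g => do return .opt (← g.canonical)
  | .seq g₁ g₂ => do return .seq (← g₁.canonical) (← g₂.canonical)
  | .star g => g.starCanonical

/-- The canonical form of `*g`. A table without excluded keys excludes the keys in `⊥`. -/
def MGroup.starCanonical : MGroup → Option EMGroup
  | .entry k t => do return .table (← k.canonical) (.base .bot) (← t.canonical)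
  | .choice g₁ g₂ => do return .seq (← g₁.starCanonical) (← g₂.starCanonical)
  | _ => none

end

/-- The base types of which a type is the alternative. -/
def ETy.leaves : ETy → List Base
  | .base b => [b]
  | .alt t₁ t₂ => t₁.leaves ++ t₂.leaves
  | _ => []

/-- An underapproximation of the intersection of two types, which is exact on alternatives of
literals (the types of excluded keys are all of this kind). -/
def ETy.cap : ETy → ETy → ETy
  | .base b, u => if b ∈ u.leaves then .base b else .base .bot
  | .alt t₁ t₂, u => .alt (t₁.cap u) (t₂.cap u)
  | _, _ => .base .bot

/-- `t / l` -/
def ETy.addLit (t : ETy) (l : Label) : ETy := .alt t (.base (.lit l))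

/-! Second step: tables are annotated with the keys to be excluded, in every map of the type. -/

mutual

def ETy.annotate : ETy → Option ETy
  | .base b => some (.base b)
  | .array a => do return .array (← a.annotate)
  | .map g => do return .map (← g.annotate (.base .bot)).2
  | .alt t₁ t₂ => do return .alt (← t₁.annotate) (← t₂.annotate)

def EAGroup.annotate : EAGroup → Option EAGroup
  | .item t => do return .item (← t.annotate)
  | .choice a₁ a₂ => do return .choice (← a₁.annotate) (← a₂.annotate)
  | .opt a => do return .opt (← a.annotate)
  | .seq a₁ a₂ => do return .seq (← a₁.annotate) (← a₂.annotate)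
  | .star a => do return .star (← a.annotate)

/-- `g.annotate t = some (t', g')` is the rewriting `(t; g) ⤳ (t'; g')`. There is no rule for `?g`
unless `g` is an entry with a cut. -/
def EMGroup.annotate : EMGroup → ETy → Option (ETy × EMGroup)
  | .entry l v, t => do return (t.addLit l, .entry l (← v.annotate))
  | .cutEntry l v, t => do return (t.addLit l, .cutEntry l (← v.annotate))
  | .opt (.cutEntry l v), t => do return (t.addLit l, .opt (.cutEntry l (← v.annotate)))
  | .opt _, _ => none
  | .choice (.seq (.cutEntry l v) g₁) g₂, t => do
      let v' ← v.annotate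
      let (t₁, g₁') ← g₁.annotate (t.addLit l)
      let (t₂, g₂') ← g₂.annotate (t.addLit l)
      return (t₁.cap t₂, .choice (.seq (.cutEntry l v') g₁') g₂')
  | .choice g₁ g₂, t => do
      let (t₁, g₁') ← g₁.annotate t
      let (t₂, g₂') ← g₂.annotate t
      return (t₁.cap t₂, .choice g₁' g₂')
  | .seq g₁ g₂, t => do
      let (t₁, g₁') ← g₁.annotate t
      let (t₂, g₂') ← g₂.annotate t₁
      return (t₂, .seq g₁' g₂')
  | .table k _ v, t => do return (t, .table (← k.annotate) t (← v.annotate))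

end

/-! Third step: disjointness checks. Two types (array groups, map groups) are disjoint if no CBOR
item (item list, finite map) is valid for both. -/

def ETy.Disj (t₁ t₂ : ETy) : Prop := ¬ ∃ x, t₁.Valid x ∧ t₂.Valid x

def EAGroup.Disj (a₁ a₂ : EAGroup) : Prop :=
  ¬ ∃ l, ASem.Matches a₁.sem l ∧ ASem.Matches a₂.sem l

def EMGroup.Disj (g₁ g₂ : EMGroup) : Prop :=
  ¬ ∃ m : Entries, m.IsMap ∧ MSem.Matches g₁.sem m ∧ MSem.Matches g₂.sem m

/-- The condition on a concatenation whose first member is a repetition: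
`*a₁, *a₂, a₃` and otherwise `*a₁, a₂`. -/
def EAGroup.StarSeqOk : EAGroup → EAGroup → Prop
  | .star a₁, .seq (.star a₂) a₃ => a₁.Disj a₂ ∧ a₁.Disj a₃
  | .star a₁, a₂ => a₁.Disj a₂
  | _, _ => True

/-- The keys that appear in a map group, without the keys excluded from its tables. -/
def EMGroup.Footprint : EMGroup → Cbor → Prop
  | .entry l _ => fun x => x = l.toCbor
  | .cutEntry l _ => fun x => x = l.toCbor
  | .table k rej _ => fun x => k.Valid x ∧ ¬ rej.Valid x
  | .choice g₁ g₂ => fun x => g₁.Footprint x ∨ g₂.Footprint x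
  | .opt g => g.Footprint
  | .seq g₁ g₂ => fun x => g₁.Footprint x ∨ g₂.Footprint x

mutual

def ETy.Checked : ETy → Prop
  | .base _ => True
  | .array a => a.Checked
  | .map g => g.Checked
  | .alt t₁ t₂ => t₁.Checked ∧ t₂.Checked ∧ t₁.Disj t₂

def EAGroup.Checked : EAGroup → Prop
  | .item t => t.Checked
  | .choice a₁ a₂ => a₁.Checked ∧ a₂.Checked ∧ a₁.Disj a₂
  | .opt a => a.Checked
  | .seq a₁ a₂ => a₁.Checked ∧ a₂.Checked ∧ a₁.StarSeqOk a₂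
  | .star a => a.Checked

def EMGroup.Checked : EMGroup → Prop
  | .entry _ t => t.Checked
  | .cutEntry _ t => t.Checked
  | .table k _ t => k.Checked ∧ t.Checked
  | .choice g₁ g₂ => g₁.Checked ∧ g₂.Checked ∧ g₁.Disj g₂
  | .opt g => g.Checked
  | .seq g₁ g₂ => g₁.Checked ∧ g₂.Checked ∧ ¬ ∃ k, g₁.Footprint k ∧ g₂.Footprint k

end

/-- Elaboration, a partial function. -/
def Ty.elaborate (t : Ty) : Option ETy := do
  let c ← t.canonical
  let t' ← c.annotate
  if t'.Checked then some t' else none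

/-! ## Type interpretation -/

/-- The interpretation of a base type. -/
def Base.Interp : Base → Type
  | .bot => Empty
  | .lit _ => Unit
  | .any => Cbor
  | .int => {n : ℤ // -2 ^ 64 ≤ n ∧ n < 2 ^ 64}
  | .uint => UInt64
  | .nint => {n : ℤ // -2 ^ 64 ≤ n ∧ n < 0}
  | .tstr => String
  | .bstr => List UInt8

mutual

/-- The type of the parsed values. -/
def ETy.Interp : ETy → Type
  | .base b => b.Interp
  | .array a => a.Interp
  | .map g => g.Interp
  | .alt t₁ t₂ => t₁.Interp ⊕ t₂.Interp

def EAGroup.Interp : EAGroup → Type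
  | .item t => t.Interp
  | .choice a₁ a₂ => a₁.Interp ⊕ a₂.Interp
  | .opt a => Option a.Interp
  | .seq a₁ a₂ => a₁.Interp × a₂.Interp
  | .star a => List a.Interp

/-- A table is a finite association of lists of values to keys. -/
def EMGroup.Interp : EMGroup → Type
  | .entry _ t => Unit × t.Interp
  | .cutEntry _ t => Unit × t.Interp
  | .table k _ t => Finmap (fun _ : k.Interp => List t.Interp)
  | .choice g₁ g₂ => g₁.Interp ⊕ g₂.Interp
  | .opt g => Option g.Interp
  | .seq g₁ g₂ => g₁.Interp × g₂.Interp

end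

/-! ## Parser specifications -/

/-- The parser of a base type. -/
def Base.parse : (b : Base) → Cbor → Option b.Interp
  | .bot, _ => none
  | .lit l, x => if x = l.toCbor then some () else none
  | .any, x => some x
  | .int, x =>
    match x.1 with
    | .int n => if h : -2 ^ 64 ≤ n ∧ n < 2 ^ 64 then some ⟨n, h⟩ else none
    | _ => none
  | .uint, x =>
    match x.1 with
    | .int n => if 0 ≤ n then some (UInt64.ofNat n.toNat) else none
    | _ => none
  | .nint, x =>
    match x.1 with
    | .int n => if h : -2 ^ 64 ≤ n ∧ n < 0 then some ⟨n, h⟩ else none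
    | _ => none
  | .tstr, x =>
    match x.1 with
    | .text s => some s
    | _ => none
  | .bstr, x =>
    match x.1 with
    | .bytes b => some b
    | _ => none

/-- Parsers of array groups return a value and the remaining items. -/
abbrev AParser (α : Type) : Type := List Cbor → Option (α × List Cbor)

namespace AParser

variable {α β : Type}

def item (p : Cbor → Option α) : AParser α
  | [] => none
  | x :: l => (p x).map (fun v => (v, l))

def choice (p₁ : AParser α) (p₂ : AParser β) : AParser (α ⊕ β) := fun l =>
  match p₁ l with
  | some (v, r) => some (.inl v, r)
  | none => (p₂ l).map (fun vr => (.inr vr.1, vr.2))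

def opt (p : AParser α) : AParser (Option α) := fun l =>
  match p l with
  | some (v, r) => some (some v, r)
  | none => some (none, l)

def seq (p₁ : AParser α) (p₂ : AParser β) : AParser (α × β) := fun l =>
  match p₁ l with
  | none => none
  | some (v₁, r₁) => (p₂ r₁).map (fun vr => ((v₁, vr.1), vr.2))

def starUpTo (p : AParser α) : ℕ → AParser (List α)
  | 0, l => some ([], l)
  | n + 1, l =>
    match p l with
    | none => some ([], l)
    | some (v, r) =>
      if r.length < l.length then (starUpTo p n r).map (fun vr => (v :: vr.1, vr.2))
      else some ([], l)

def star (p : AParser α) : AParser (List α) := fun l => starUpTo p l.length l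

end AParser

/-- The outcome of a map group parser: a cut fails, the group does not match, or a result. -/
inductive Outcome (α : Type) : Type
  | cut
  | fail
  | ok (a : α)

/-- Parsers of map groups return a value and the remaining entries. -/
abbrev MParser (α : Type) : Type := Entries → Outcome (α × Entries)

/-- The value of a key. -/
def Entries.lookup (m : Entries) (k : Cbor) : Option Cbor :=
  if h : ∃ v, (k, v) ∈ m then some h.choose else none

/-- The finite association of each key that occurs in a list to the list of its values. -/
def groupByKey {K V : Type} (l : List (K × V)) : Finmap (fun _ : K => List V) :=
  List.toFinmap (l.map (fun e => ⟨e.1, (l.filter (fun e' => e'.1 = e.1)).map Prod.snd⟩))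

namespace MParser

variable {α β : Type}

def entry (l : Label) (p : Cbor → Option α) : MParser (Unit × α) := fun m =>
  match m.lookup l.toCbor with
  | none => .fail
  | some x =>
    match p x with
    | none => .fail
    | some v => .ok (((), v), m.erase (l.toCbor, x))

def cutEntry (l : Label) (p : Cbor → Option α) : MParser (Unit × α) := fun m =>
  match m.lookup l.toCbor with
  | none => .fail
  | some x =>
    match p x with
    | none => .cut
    | some v => .ok (((), v), m.erase (l.toCbor, x))

/-- `pk` and `pv` are the parsers of the keys and values, and `E` holds of the entries of the
table. -/
def table (E : Cbor × Cbor → Prop) (pk : Cbor → Option α) (pv : Cbor → Option β) :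
    MParser (Finmap (fun _ : α => List β)) := fun m =>
  match (m.filter E).toList.mapM (fun e => (pk e.1).bind (fun k => (pv e.2).map (fun v => (k, v)))) with
  | none => .fail
  | some l => .ok (groupByKey l, m.filter (fun e => ¬ E e))

def choice (p₁ : MParser α) (p₂ : MParser β) : MParser (α ⊕ β) := fun m =>
  match p₁ m with
  | .cut => .cut
  | .ok (v, r) => .ok (.inl v, r)
  | .fail =>
    match p₂ m with
    | .cut => .cut
    | .fail => .fail
    | .ok (v, r) => .ok (.inr v, r)

def opt (p : MParser α) : MParser (Option α) := fun m =>
  match p m with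
  | .cut => .cut
  | .fail => .ok (none, m)
  | .ok (v, r) => .ok (some v, r)

def seq (p₁ : MParser α) (p₂ : MParser β) : MParser (α × β) := fun m =>
  match p₁ m with
  | .cut => .cut
  | .fail => .fail
  | .ok (v₁, r₁) =>
    match p₂ r₁ with
    | .cut => .cut
    | .fail => .fail
    | .ok (v₂, r₂) => .ok ((v₁, v₂), r₂)

end MParser

mutual

/-- The parser of a type, as a partial function on CBOR items. -/
def ETy.parse : (t : ETy) → Cbor → Option t.Interp
  | .base b => b.parse
  | .array a => fun x =>
    match x.asArray with
    | none => none
    | some l =>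
      match a.parse l with
      | some (v, []) => some v
      | _ => none
  | .map g => fun x =>
    match x.asMap with
    | none => none
    | some m =>
      match g.parse m with
      | .ok (v, r) => if r = ∅ then some v else none
      | _ => none
  | .alt t₁ t₂ => fun x =>
    if t₁.Valid x then (t₁.parse x).map Sum.inl else (t₂.parse x).map Sum.inr

def EAGroup.parse : (a : EAGroup) → AParser a.Interp
  | .item t => AParser.item t.parse
  | .choice a₁ a₂ => AParser.choice a₁.parse a₂.parse
  | .opt a => AParser.opt a.parse
  | .seq a₁ a₂ => AParser.seq a₁.parse a₂.parse
  | .star a => AParser.star a.parse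

def EMGroup.parse : (g : EMGroup) → MParser g.Interp
  | .entry l t => MParser.entry l t.parse
  | .cutEntry l t => MParser.cutEntry l t.parse
  | .table k rej t =>
      MParser.table (fun e => k.Valid e.1 ∧ ¬ rej.Valid e.1 ∧ t.Valid e.2) k.parse t.parse
  | .choice g₁ g₂ => MParser.choice g₁.parse g₂.parse
  | .opt g => MParser.opt g.parse
  | .seq g₁ g₂ => MParser.seq g₁.parse g₂.parse

end

/-- The interpretation of the canonical form, where there is one. -/
def interpOption : Option ETy → Type
  | none => Empty
  | some c => c.Interp

/-- The parser of the canonical form, where there is one. -/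
def parseOption : (o : Option ETy) → Cbor → Option (interpOption o)
  | none, _ => none
  | some c, x => c.parse x

/-- The interpretation of a CDDL type. -/
def Ty.Interp (t : Ty) : Type := interpOption t.canonical

/-- The parser of a CDDL type. -/
def Ty.parse (t : Ty) : Cbor → Option t.Interp := parseOption t.canonical

/-- The partial function `parse` restricts to a total function `p` on the valid items, which is
injective, with a serializability predicate `σ` and a serializer `s`. -/
def Unambiguous (V : Cbor → Prop) {U : Type} (parse : Cbor → Option U) : Prop :=
  ∃ p : {x : Cbor // V x} → U,
    (∀ x, parse x.1 = some (p x)) ∧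
    Function.Injective p ∧
    ∃ σ : U → Bool,
      (∀ x, σ (p x) = true) ∧
      ∃ s : {u : U // σ u = true} → {x : Cbor // V x}, ∀ u, p (s u) = u.1

end

end CDDL

namespace CDDL

open scoped Classical

-- A parsed value loses nothing: its tags, options, pairs and lists record which branches were taken
-- and how often groups were repeated, so the consumed data can be rebuilt from the value alone.
-- `Faithful` packages this as a reconstruction function together with the fact that parsing
-- succeeds exactly on valid items. The rest is formal (`Faithful.unambiguous`): reconstruction
-- gives injectivity, the predicate `σ` is membership in the range of the parser, and the serializer
-- chooses a preimage.
--
-- Faithfulness is proved by one mutual induction over types, array groups and map groups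
-- (`ETy.faithful`, `EAGroup.faithful`, `EMGroup.faithful`). For groups the invariant must also
-- follow the remainder: parser and semantics leave the same rest, and the input is the
-- reconstructed part together with that rest. When the rest is empty, the value therefore
-- determines the whole input. For map groups the invariant adds that the set-valued semantics has
-- at most one result on a finite map. The delicate constructors are array repetition, where two
-- tests for lack of progress must agree, and tables, where grouping values by key must not lose
-- entries.
--
-- This settles the elaborated type. A CDDL type is parsed through its canonical form, so it remains
-- to see that canonicalization preserves validity (`Ty.canonical_valid`). The substantial case is
-- `*(e₁ // e₂ // …)`: whatever entries are picked, and in whatever order, the repetition ends up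
-- removing precisely the entries that fit some alternative, which is also what the successive
-- tables remove (`MSem.Picks.star`, `MSem.seq_filter`).

/-- A parser is defined exactly on the valid items, and its value determines the item. -/
def Faithful {α : Type} (V : Cbor → Prop) (p : Cbor → Option α) : Prop :=
  (∀ x, V x ↔ (p x).isSome) ∧ ∃ f : α → Cbor, ∀ x v, p x = some v → x = f v

theorem Faithful.unambiguous {α : Type} {V : Cbor → Prop} {p : Cbor → Option α}
    (h : Faithful V p) : Unambiguous V p := by
  obtain ⟨hV, f, hf⟩ := h
  have hp : ∀ x : {x // V x}, p x.1 = some ((p x.1).get ((hV x.1).1 x.2)) := by simp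
  refine ⟨fun x => (p x.1).get ((hV x.1).1 x.2), hp, ?_,
    fun u => decide (∃ x : {x // V x}, p x.1 = some u), ?_, ?_⟩
  · intro x y hxy
    have hy := hp y
    rw [← show _ = (p y.1).get _ from hxy] at hy
    exact Subtype.ext ((hf _ _ (hp x)).trans (hf _ _ hy).symm)
  · intro x
    exact decide_eq_true ⟨x, hp x⟩
  · refine ⟨fun u => (of_decide_eq_true u.2).choose, fun u => ?_⟩
    have hu := (of_decide_eq_true u.2).choose_spec
    exact Option.some_injective _ ((hp _).symm.trans hu)

-- Array groups

/-- A parser of an array group follows the semantics, and its value determines what is consumed. -/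
def AFaithful {α : Type} (s : ASem) (p : AParser α) : Prop :=
  ∃ f : α → List Cbor, ∀ l, s l = (p l).map (fun vr => (f vr.1, vr.2)) ∧
    ∀ v r, p l = some (v, r) → l = f v ++ r

namespace AFaithful

variable {α β : Type} {s s₁ s₂ : ASem} {p : AParser α} {p₁ : AParser α} {p₂ : AParser β}

theorem item {V : Cbor → Prop} {p : Cbor → Option α} (h : Faithful V p) :
    AFaithful (ASem.item V) (AParser.item p) := by
  obtain ⟨hV, f, hf⟩ := h
  refine ⟨fun v => [f v], fun l => ?_⟩
  cases l with
  | nil => simp [ASem.item, AParser.item]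
  | cons x l =>
    simp only [ASem.item, AParser.item, hV]
    cases hx : p x with
    | none => simp
    | some v => simpa using hf x v hx

theorem choice (h₁ : AFaithful s₁ p₁) (h₂ : AFaithful s₂ p₂) :
    AFaithful (ASem.choice s₁ s₂) (AParser.choice p₁ p₂) := by
  obtain ⟨f₁, h₁⟩ := h₁
  obtain ⟨f₂, h₂⟩ := h₂
  refine ⟨Sum.elim f₁ f₂, fun l => ?_⟩
  simp only [ASem.choice, AParser.choice, (h₁ l).1, (h₂ l).1]
  cases hp₁ : p₁ l with
  | some vr => simpa using (h₁ l).2 _ _ hp₁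
  | none =>
    cases hp₂ : p₂ l with
    | none => simp
    | some vr => simpa using (h₂ l).2 _ _ hp₂

theorem opt (h : AFaithful s p) : AFaithful (ASem.opt s) (AParser.opt p) := by
  obtain ⟨f, h⟩ := h
  refine ⟨fun o => o.elim [] f, fun l => ?_⟩
  simp only [ASem.opt, AParser.opt, (h l).1]
  cases hp : p l with
  | some vr => simpa using (h l).2 _ _ hp
  | none => simp

theorem seq (h₁ : AFaithful s₁ p₁) (h₂ : AFaithful s₂ p₂) :
    AFaithful (ASem.seq s₁ s₂) (AParser.seq p₁ p₂) := by
  obtain ⟨f₁, h₁⟩ := h₁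
  obtain ⟨f₂, h₂⟩ := h₂
  refine ⟨fun v => f₁ v.1 ++ f₂ v.2, fun l => ?_⟩
  simp only [ASem.seq, AParser.seq, (h₁ l).1]
  cases hp₁ : p₁ l with
  | none => simp
  | some vr =>
    simp only [Option.map_some, (h₂ vr.2).1]
    cases hp₂ : p₂ vr.2 with
    | none => simp
    | some wr =>
      simpa [← (h₂ vr.2).2 _ _ hp₂] using (h₁ l).2 _ _ hp₁

/-- The reconstruction is chosen before the bound `n`, because `star` takes the length of the input
as bound and the value alone must suffice to rebuild it. -/
theorem starUpTo (h : AFaithful s p) :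
    ∃ f : List α → List Cbor, ∀ n l,
      s.starUpTo n l = (AParser.starUpTo p n l).map (fun vr => (f vr.1, vr.2)) ∧
        ∀ v r, AParser.starUpTo p n l = some (v, r) → l = f v ++ r := by
  obtain ⟨f, h⟩ := h
  refine ⟨List.flatMap f, fun n => ?_⟩
  induction n with
  | zero => simp [ASem.starUpTo, AParser.starUpTo]
  | succ n ih =>
    intro l
    simp only [ASem.starUpTo, AParser.starUpTo, (h l).1]
    cases hp : p l with
    | none => simp
    | some vr =>
      obtain ⟨v, r⟩ := vr
      have hl := (h l).2 _ _ hp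
      simp only [Option.map_some]
      -- The semantics stops when nothing is consumed, the parser when the rest is not shorter.
      -- Since the input is `f v ++ r`, both tests amount to `f v = []`.
      cases hv : f v with
      | nil => simp [hl, hv]
      | cons x c =>
        have hlt : r.length < l.length := by
          rw [hl, hv]
          simp
        simp only [hlt, if_true, (ih r).1]
        cases hr : AParser.starUpTo p n r with
        | none => simp
        | some wr =>
          simpa [← (ih r).2 _ _ hr, hv] using hl

theorem star (h : AFaithful s p) : AFaithful s.star (AParser.star p) := by
  obtain ⟨f, hf⟩ := starUpTo h
  exact ⟨f, fun l => hf l.length l⟩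

end AFaithful

-- Map groups

/-- A parser of a map group follows the semantics on finite maps, which is deterministic there, and
its value determines what is consumed. -/
def MFaithful {α : Type} (s : MSem) (p : MParser α) : Prop :=
  ∃ f : α → Entries, ∀ m : Entries, m.IsMap →
    (p m = .cut → s m = none) ∧
    (p m = .fail → s m = some ∅) ∧
    ∀ v r, p m = .ok (v, r) → s m = some {(f v, r)} ∧ m = f v ∪ r

theorem Entries.IsMap.mono {m m' : Entries} (h : m.IsMap) (hm : m' ⊆ m) : m'.IsMap :=
  fun e he e' he' => h e (hm he) e' (hm he')

theorem Entries.IsMap.lookup_eq_some {m : Entries} (h : m.IsMap) {k v : Cbor} :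
    m.lookup k = some v ↔ (k, v) ∈ m := by
  unfold Entries.lookup
  split_ifs with hk
  · constructor
    · intro hv
      rw [← Option.some_injective _ hv]
      exact hk.choose_spec
    · intro hv
      exact congrArg some (congrArg Prod.snd (h _ hk.choose_spec _ hv rfl))
  · simpa using fun hv => hk ⟨v, hv⟩

theorem MSem.extend_singleton (c r : Entries)
    (k : Entries → Entries → Option (Set (Entries × Entries))) :
    MSem.extend {(c, r)} k = (k c r).map (fun T => {cr | ∃ cr₂ ∈ T, cr = (c ∪ cr₂.1, cr₂.2)}) := by
  unfold MSem.extend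
  cases h : k c r <;> simp [h]

theorem MSem.extend_empty (k : Entries → Entries → Option (Set (Entries × Entries))) :
    MSem.extend ∅ k = some ∅ := by
  simp [MSem.extend]

/-- Consumption of all entries in `E`. -/
def MSem.filter (E : Cbor × Cbor → Prop) : MSem := fun m =>
  some {(Finset.filter E m, Finset.filter (fun e => ¬ E e) m)}

theorem MSem.table_eq (P R Q : Cbor → Prop) :
    MSem.table P R Q = MSem.filter (fun e => P e.1 ∧ ¬ R e.1 ∧ Q e.2) := by
  funext m
  unfold MSem.table MSem.filter
  -- The two sides differ at most in their decidability instances.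
  congr!

/-- Removing duplicate keys is harmless when the value is a function of the key, since the discarded
pairs equal the kept ones. In `groupByKey` every occurrence of a key carries the same full list of
values. -/
theorem mem_dedupKeys_of_function {K V : Type} {l : List (Sigma fun _ : K => V)} (F : K → V)
    (hl : ∀ e ∈ l, e.2 = F e.1) (k : K) (v : V) :
    (⟨k, v⟩ : Sigma fun _ : K => V) ∈ l.dedupKeys ↔ ⟨k, v⟩ ∈ l := by
  rw [← List.mem_dlookup_iff (List.nodupKeys_dedupKeys l), List.dlookup_dedupKeys]
  refine ⟨List.of_mem_dlookup, fun h => ?_⟩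
  obtain ⟨w, hw⟩ := Option.isSome_iff_exists.1 (List.dlookup_isSome.2 (List.mem_keys_of_mem h))
  rw [hw, Option.mem_some_iff]
  exact (hl _ (List.of_mem_dlookup hw)).trans (hl _ h).symm

theorem mem_groupByKey {K V : Type} (l : List (K × V)) (k : K) (vs : List V) :
    (⟨k, vs⟩ : Sigma fun _ : K => List V) ∈ (groupByKey l).entries ↔
      (∃ v, (k, v) ∈ l) ∧ vs = (l.filter (fun e => e.1 = k)).map Prod.snd := by
  change _ ∈ List.dedupKeys _ ↔ _
  rw [mem_dedupKeys_of_function (fun k => (l.filter (fun e => e.1 = k)).map Prod.snd)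
    (by rintro _ he; obtain ⟨e, -, rfl⟩ := List.mem_map.1 he; rfl)]
  simp only [List.mem_map, Sigma.mk.injEq, Prod.exists, heq_eq_eq]
  constructor
  · rintro ⟨_, v, h, rfl, rfl⟩
    exact ⟨⟨v, h⟩, rfl⟩
  · rintro ⟨⟨v, h⟩, rfl⟩
    exact ⟨k, v, h, rfl, rfl⟩

theorem _root_.List.exists_mapM_eq_some {α β : Type} {q : α → Option β} (l : List α)
    (h : ∀ a ∈ l, ∃ b, q a = some b) :
    ∃ L, l.mapM q = some L ∧ ∀ b, b ∈ L ↔ ∃ a ∈ l, q a = some b := by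
  induction l with
  | nil => exact ⟨[], by simp⟩
  | cons a l ih =>
    obtain ⟨b, hb⟩ := h a List.mem_cons_self
    obtain ⟨L, hL, hmem⟩ := ih fun a ha => h a (List.mem_cons_of_mem _ ha)
    exact ⟨b :: L, by simp [hb, hL], fun b' => by simp [hmem, hb, eq_comm]⟩

namespace MFaithful

variable {α β : Type} {s s₁ s₂ : MSem} {p : MParser α} {p₁ : MParser α} {p₂ : MParser β}

/-- Absence of duplicate keys leaves at most one entry with the given label, so the set of results
is empty or a singleton and `Entries.lookup` finds the only candidate. -/
theorem entry {V : Cbor → Prop} {p : Cbor → Option α} (l : Label) (h : Faithful V p) :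
    MFaithful (MSem.entry (fun x => x = l.toCbor) V) (MParser.entry l p) := by
  obtain ⟨hV, f, hf⟩ := h
  refine ⟨fun v => {(l.toCbor, f v.2)}, fun m hm => ?_⟩
  unfold MSem.entry MParser.entry
  cases hl : m.lookup l.toCbor with
  | none =>
    have : ∀ x, (l.toCbor, x) ∉ m := fun x hx => by
      simp [hm.lookup_eq_some.2 hx] at hl
    simp [this]
  | some x =>
    have hx := hm.lookup_eq_some.1 hl
    have huniq : ∀ y, (l.toCbor, y) ∈ m → y = x := fun y hy =>
      congrArg Prod.snd (hm _ hy _ hx rfl)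
    dsimp only
    cases hpx : p x with
    | none =>
      have : ∀ y, (l.toCbor, y) ∈ m → ¬ V y := fun y hy hy' => by
        simp [hV, huniq y hy, hpx] at hy'
      simpa [Set.eq_empty_iff_forall_notMem] using fun _ _ y hy hy' => absurd hy' (this y hy)
    | some v =>
      have hVx : V x := by simp [hV, hpx]
      have := hf x v hpx
      subst this
      simp only [reduceCtorEq, false_implies, true_and, Outcome.ok.injEq, Prod.mk.injEq]
      rintro _ _ ⟨rfl, rfl⟩
      refine ⟨?_, ?_⟩
      · congr 1
        ext cr
        simp only [Set.mem_ofPred_eq, Set.mem_singleton_iff]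
        constructor
        · rintro ⟨⟨k, y⟩, he, rfl, _, rfl⟩
          cases huniq y he
          rfl
        · rintro rfl
          exact ⟨_, hx, rfl, hVx, rfl⟩
      · rw [← Finset.insert_eq, Finset.insert_erase hx]

/-- The cut changes the outcome only if the label is present with an invalid value; every other case
is inherited from `entry`, with the same reconstruction. -/
theorem cutEntry {V : Cbor → Prop} {p : Cbor → Option α} (l : Label) (h : Faithful V p) :
    MFaithful (MSem.cutEntry (fun x => x = l.toCbor) V) (MParser.cutEntry l p) := by
  obtain ⟨f, hf⟩ := entry l h
  refine ⟨f, fun m hm => ?_⟩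
  have h' := hf m hm
  unfold MParser.cutEntry
  unfold MParser.entry at h'
  unfold MSem.cutEntry
  cases hl : m.lookup l.toCbor with
  | none =>
    have : ¬ ∃ e ∈ m, e.1 = l.toCbor ∧ ¬ V e.2 := by
      rintro ⟨⟨k, x⟩, hx, rfl, _⟩
      simp [hm.lookup_eq_some.2 hx] at hl
    simpa [this, hl] using h'
  | some x =>
    have hx := hm.lookup_eq_some.1 hl
    dsimp only
    cases hpx : p x with
    | none =>
      have : ∃ e ∈ m, e.1 = l.toCbor ∧ ¬ V e.2 := ⟨_, hx, rfl, by simp [h.1, hpx]⟩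
      simp only [if_pos this]
      simp
    | some v =>
      have : ¬ ∃ e ∈ m, e.1 = l.toCbor ∧ ¬ V e.2 := by
        rintro ⟨⟨k, y⟩, hy, rfl, hn⟩
        cases congrArg Prod.snd (hm _ hy _ hx rfl)
        simp [h.1, hpx] at hn
      simp only [if_neg this]
      simpa [hl, hpx] using h'

theorem choice (h₁ : MFaithful s₁ p₁) (h₂ : MFaithful s₂ p₂) :
    MFaithful (MSem.choice s₁ s₂) (MParser.choice p₁ p₂) := by
  obtain ⟨f₁, h₁⟩ := h₁
  obtain ⟨f₂, h₂⟩ := h₂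
  refine ⟨Sum.elim f₁ f₂, fun m hm => ?_⟩
  replace h₁ := h₁ m hm
  replace h₂ := h₂ m hm
  unfold MSem.choice MParser.choice
  cases hp₁ : p₁ m with
  | cut => simp [h₁.1 hp₁]
  | ok vr =>
    obtain ⟨hs, hu⟩ := h₁.2.2 vr.1 vr.2 hp₁
    simpa [hs] using hu
  | fail =>
    simp only [h₁.2.1 hp₁]
    cases hp₂ : p₂ m with
    | cut => simp [h₂.1 hp₂]
    | fail => simp [h₂.2.1 hp₂]
    | ok vr =>
      obtain ⟨hs, hu⟩ := h₂.2.2 vr.1 vr.2 hp₂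
      simpa [hs] using hu

theorem opt (h : MFaithful s p) : MFaithful (MSem.opt s) (MParser.opt p) := by
  obtain ⟨f, h⟩ := h
  refine ⟨fun o => o.elim ∅ f, fun m hm => ?_⟩
  replace h := h m hm
  unfold MSem.opt MParser.opt
  cases hp : p m with
  | cut => simp [h.1 hp]
  | fail => simp [h.2.1 hp]
  | ok vr =>
    obtain ⟨hs, hu⟩ := h.2.2 vr.1 vr.2 hp
    simpa [hs] using hu

theorem seq (h₁ : MFaithful s₁ p₁) (h₂ : MFaithful s₂ p₂) :
    MFaithful (MSem.seq s₁ s₂) (MParser.seq p₁ p₂) := by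
  obtain ⟨f₁, h₁⟩ := h₁
  obtain ⟨f₂, h₂⟩ := h₂
  refine ⟨fun v => f₁ v.1 ∪ f₂ v.2, fun m hm => ?_⟩
  replace h₁ := h₁ m hm
  unfold MSem.seq MParser.seq
  cases hp₁ : p₁ m with
  | cut => simp [h₁.1 hp₁]
  | fail => simp [h₁.2.1 hp₁, MSem.extend_empty]
  | ok vr =>
    obtain ⟨v, r⟩ := vr
    obtain ⟨hs, hu⟩ := h₁.2.2 v r hp₁
    -- The rest is a subset of `m`, hence still free of duplicate keys.
    replace h₂ := h₂ r (hm.mono (hu ▸ Finset.subset_union_right))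
    simp only [hs, MSem.extend_singleton]
    cases hp₂ : p₂ r with
    | cut => simp [h₂.1 hp₂]
    | fail => simp [h₂.2.1 hp₂]
    | ok wr =>
      obtain ⟨hs₂, hu₂⟩ := h₂.2.2 wr.1 wr.2 hp₂
      simp only [hs₂, reduceCtorEq, false_implies, true_and, Outcome.ok.injEq, Prod.mk.injEq]
      rintro _ _ ⟨rfl, rfl⟩
      refine ⟨by simp, ?_⟩
      rw [Finset.union_assoc, ← hu₂, ← hu]

/-- Tables with an opaque entry predicate and a single parser `q` for entries. The order in which
the entries are listed does not matter: the reconstruction pairs each key with each value of its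
list and collects the pairs into a set. -/
theorem tableOn {E : Cbor × Cbor → Prop} {q : Cbor × Cbor → Option (α × β)}
    {f : α → Cbor} {g : β → Cbor} (hqE : ∀ e, E e → ∃ b, q e = some b)
    (hqf : ∀ e k v, q e = some (k, v) → (f k, g v) = e) :
    MFaithful (fun m => some {(m.filter E, m.filter (fun e => ¬ E e))}) (fun m =>
      match (m.filter E).toList.mapM q with
      | none => .fail
      | some l => .ok (groupByKey l, m.filter (fun e => ¬ E e))) := by
  refine ⟨fun F => F.entries.toFinset.biUnion
    (fun e => (e.2.map (fun v => (f e.1, g v))).toFinset), fun m hm => ?_⟩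
  obtain ⟨L, hL, hmem⟩ := List.exists_mapM_eq_some (m.filter E).toList
    (fun e he => hqE e (Finset.mem_filter.1 (Finset.mem_toList.1 he)).2)
  simp only [Finset.mem_toList] at hmem
  simp only [hL, reduceCtorEq, false_implies, true_and, Outcome.ok.injEq, Prod.mk.injEq]
  rintro _ _ ⟨rfl, rfl⟩
  have hfil : ((groupByKey L).entries.toFinset.biUnion
      (fun e => (e.2.map (fun v => (f e.1, g v))).toFinset)) = m.filter E := by
    ext e
    simp only [Finset.mem_biUnion, Multiset.mem_toFinset, Sigma.exists, mem_groupByKey,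
      List.mem_toFinset, List.mem_map]
    constructor
    · rintro ⟨k, _, ⟨-, rfl⟩, v, hv, rfl⟩
      simp only [List.mem_map, List.mem_filter, decide_eq_true_eq, Prod.exists] at hv
      obtain ⟨_, _, ⟨hkv, rfl⟩, rfl⟩ := hv
      obtain ⟨e, he, hqe⟩ := (hmem _).1 hkv
      rwa [hqf e _ _ hqe]
    · intro he
      obtain ⟨⟨k, v⟩, hb⟩ := hqE e (Finset.mem_filter.1 he).2
      have hkv := (hmem _).2 ⟨e, he, hb⟩
      refine ⟨k, _, ⟨⟨v, hkv⟩, rfl⟩, v, ?_, hqf e k v hb⟩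
      simpa using hkv
  rw [hfil]
  exact ⟨rfl, (Finset.filter_union_filter_not_eq _ _).symm⟩

theorem table {K V R : Cbor → Prop} {pk : Cbor → Option α} {pv : Cbor → Option β}
    (hk : Faithful K pk) (hv : Faithful V pv) :
    MFaithful (MSem.table K R V)
      (MParser.table (fun e => K e.1 ∧ ¬ R e.1 ∧ V e.2) pk pv) := by
  obtain ⟨hK, f, hf⟩ := hk
  obtain ⟨hV, g, hg⟩ := hv
  rw [MSem.table_eq]
  refine tableOn (f := f) (g := g) ?_ ?_
  · rintro e ⟨h1, -, h2⟩
    obtain ⟨k, hk⟩ := Option.isSome_iff_exists.1 ((hK _).1 h1)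
    obtain ⟨v, hv⟩ := Option.isSome_iff_exists.1 ((hV _).1 h2)
    exact ⟨(k, v), by simp [hk, hv]⟩
  · intro e k v h
    simp only [Option.bind_eq_some_iff, Option.map_eq_some_iff, Prod.mk.injEq] at h
    obtain ⟨_, h1, _, h2, rfl, rfl⟩ := h
    rw [← hf _ _ h1, ← hg _ _ h2]

end MFaithful

-- Base types

theorem Faithful.intro {α : Type} {V : Cbor → Prop} {p : Cbor → Option α} (f : α → Cbor)
    (hV : ∀ x, V x → ∃ v, p x = some v) (hp : ∀ x v, p x = some v → V x ∧ x = f v) :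
    Faithful V p :=
  ⟨fun x => ⟨fun h => Option.isSome_iff_exists.2 (hV x h),
    fun h => (Option.isSome_iff_exists.1 h).elim fun v hv => (hp x v hv).1⟩,
    f, fun x v h => (hp x v h).2⟩

theorem Raw.Canonical.int_bounds {n : ℤ} (h : Raw.Canonical (.int n)) :
    -2 ^ 64 ≤ n ∧ n < 2 ^ 64 := by
  cases h
  constructor <;> assumption

theorem Raw.Canonical.map_sorted {es : List (Raw × Raw)} (h : Raw.Canonical (.map es)) :
    es.Pairwise (fun e e' => WellOrderingRel e.1 e'.1) := by
  cases h
  assumption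

instance : Inhabited Cbor := ⟨⟨.int 0, .int (by norm_num) (by norm_num)⟩⟩

/-- Useful where the value type is larger than the set of items, as for strings of unbounded length:
outside the range of the parser the reconstruction takes a default value. -/
theorem Faithful.of_injective {α : Type} {V : Cbor → Prop} {p : Cbor → Option α}
    (hV : ∀ x, V x → ∃ v, p x = some v) (hV' : ∀ x v, p x = some v → V x)
    (hp : ∀ x y v, p x = some v → p y = some v → x = y) : Faithful V p := by
  refine .intro (fun v => if h : ∃ x, p x = some v then h.choose else default) hV
    fun x v h => ⟨hV' x v h, ?_⟩
  have hx : ∃ x, p x = some v := ⟨x, h⟩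
  rw [dif_pos hx]
  exact hp _ _ _ h hx.choose_spec

theorem Base.faithful (b : Base) : Faithful b.Valid b.parse := by
  cases b with
  | bot => exact .of_injective (fun _ h => h.elim) (fun _ v => nomatch v) (fun _ _ v => nomatch v)
  | lit l =>
    have key : ∀ x v, (Base.lit l).parse x = some v → x = l.toCbor := by
      intro x v h
      by_contra hx
      exact absurd ((if_neg hx).symm.trans h) (fun h => nomatch h)
    exact .of_injective (fun x h => ⟨(), if_pos h⟩) key
      (fun x y v hx hy => (key x v hx).trans (key y v hy).symm)
  | any =>
    exact .intro id (fun x _ => ⟨x, rfl⟩) fun x v h => ⟨trivial, Option.some_injective _ h⟩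
  | int =>
    refine .intro (fun n => ⟨.int n.1, .int n.2.1 n.2.2⟩) ?_ ?_
    · rintro ⟨_, hx⟩ ⟨n, rfl⟩
      exact ⟨⟨n, hx.int_bounds⟩, dif_pos hx.int_bounds⟩
    · rintro ⟨x, hx⟩ v h
      cases x with
      | int n =>
        cases Option.some_injective _ ((dif_pos hx.int_bounds).symm.trans h)
        exact ⟨⟨n, rfl⟩, rfl⟩
      | _ => exact nomatch h
  | uint =>
    refine .intro (fun n : UInt64 =>
      ⟨.int n.toNat, .int (by omega) (by have := n.toNat_lt; omega)⟩) ?_ ?_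
    · rintro ⟨_, hx⟩ ⟨n, rfl, h⟩
      exact ⟨UInt64.ofNat n.toNat, if_pos h⟩
    · rintro ⟨x, hx⟩ v h
      cases x with
      | int n =>
        by_cases h0 : 0 ≤ n
        · cases Option.some_injective _ ((if_pos h0).symm.trans h)
          refine ⟨⟨n, rfl, h0⟩, Subtype.ext (congrArg Raw.int ?_)⟩
          -- The conversion to 64 bits reduces modulo `2 ^ 64`; canonicity bounds `n`, so nothing is
          -- lost.
          have := hx.int_bounds
          rw [UInt64.toNat_ofNat']
          omega
        · exact nomatch (if_neg h0).symm.trans h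
      | _ => exact nomatch h
  | nint =>
    refine .intro (fun n => ⟨.int n.1, .int n.2.1 (n.2.2.trans (by norm_num))⟩) ?_ ?_
    · rintro ⟨_, hx⟩ ⟨n, rfl, h⟩
      exact ⟨⟨n, hx.int_bounds.1, h⟩, dif_pos ⟨hx.int_bounds.1, h⟩⟩
    · rintro ⟨x, hx⟩ v h
      cases x with
      | int n =>
        by_cases h0 : -2 ^ 64 ≤ n ∧ n < 0
        · cases Option.some_injective _ ((dif_pos h0).symm.trans h)
          exact ⟨⟨n, rfl, h0.2⟩, rfl⟩
        · exact nomatch (dif_neg h0).symm.trans h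
      | _ => exact nomatch h
  | tstr =>
    refine .of_injective ?_ ?_ ?_
    · rintro ⟨_, hx⟩ ⟨s, rfl⟩
      exact ⟨s, rfl⟩
    · rintro ⟨x, hx⟩ v h
      cases x with
      | text s => exact ⟨s, rfl⟩
      | _ => exact nomatch h
    · rintro ⟨x, hx⟩ ⟨y, hy⟩ v h h'
      cases x with
      | text s =>
        cases y with
        | text s' =>
          cases Option.some_injective _ (h.trans h'.symm)
          rfl
        | _ => exact nomatch h'
      | _ => exact nomatch h
  | bstr =>
    refine .of_injective ?_ ?_ ?_
    · rintro ⟨_, hx⟩ ⟨s, rfl⟩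
      exact ⟨s, rfl⟩
    · rintro ⟨x, hx⟩ v h
      cases x with
      | bytes s => exact ⟨s, rfl⟩
      | _ => exact nomatch h
    · rintro ⟨x, hx⟩ ⟨y, hy⟩ v h h'
      cases x with
      | bytes s =>
        cases y with
        | bytes s' =>
          cases Option.some_injective _ (h.trans h'.symm)
          rfl
        | _ => exact nomatch h'
      | _ => exact nomatch h

-- From groups to array and map items

theorem Cbor.asArray_eq_some {x : Cbor} {l : List Cbor} (h : x.asArray = some l) :
    x.1 = .array (l.map Subtype.val) := by
  obtain ⟨x, hx⟩ := x
  cases x with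
  | array xs =>
    cases Option.some_injective _ h
    have : List.map Subtype.val (xs.pmap Subtype.mk hx.array_items) = xs := by
      rw [List.map_pmap]
      simp
    exact congrArg Raw.array this.symm
  | _ => exact nomatch h

theorem Cbor.asMap_eq_some {x : Cbor} {m : Entries} (h : x.asMap = some m) :
    ∃ es : List (Raw × Raw), x.1 = .map es ∧
      (∀ e, e ∈ es ↔ ∃ e' ∈ m, e = (e'.1.1, e'.2.1)) ∧
      es.Pairwise (fun e e' => WellOrderingRel e.1 e'.1) := by
  obtain ⟨x, hx⟩ := x
  cases x with
  | map es =>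
    refine ⟨es, rfl, ?_, hx.map_sorted⟩
    have hm : ∀ e' : Cbor × Cbor, e' ∈ m ↔ e' ∈ es.pmap (fun e he =>
        ((⟨e.1, he.1⟩ : Cbor), (⟨e.2, he.2⟩ : Cbor))) hx.map_entries := by
      intro e'
      rw [← Option.some_injective _ h]
      exact @List.mem_toFinset ({r : Raw // r.Canonical} × {r : Raw // r.Canonical}) _ _ _
    intro e
    constructor
    · exact fun he => ⟨_, (hm _).2 (List.mem_pmap.2 ⟨e, he, rfl⟩), rfl⟩
    · rintro ⟨e', he', rfl⟩
      obtain ⟨e, he, rfl⟩ := List.mem_pmap.1 ((hm _).1 he')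
      exact he
  | _ => exact nomatch h

/-- A finite set has only one strictly sorted listing: the two lists of entries are duplicate-free
with the same members, hence permutations of each other, and sortedness makes them equal. -/
theorem Cbor.asMap_inj {x y : Cbor} {m : Entries} (hx : x.asMap = some m)
    (hy : y.asMap = some m) : x = y := by
  obtain ⟨es, hx, hm, hs⟩ := Cbor.asMap_eq_some hx
  obtain ⟨es', hy, hm', hs'⟩ := Cbor.asMap_eq_some hy
  have : es = es' := List.Perm.eq_of_pairwise (le := fun e e' => WellOrderingRel e.1 e'.1)
      -- Antisymmetry is vacuous for a strict order.
      (fun a b _ _ h h' => (asymm h h').elim) hs hs' ((List.perm_ext_iff_of_nodup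
        (hs.imp (fun h e => by subst e; exact irrefl _ h))
        (hs'.imp (fun h e => by subst e; exact irrefl _ h))).2
          fun e => (hm e).trans (hm' e).symm)
  exact Subtype.ext (hx.trans ((congrArg _ this).trans hy.symm))

theorem Cbor.asMap_isMap {x : Cbor} {m : Entries} (hx : x.asMap = some m) : m.IsMap := by
  obtain ⟨es, -, hm, hs⟩ := Cbor.asMap_eq_some hx
  have hinj : ∀ a ∈ es, ∀ b ∈ es, a.1 = b.1 → a = b :=
    -- Entries at different positions have strictly related keys, so equal keys force the same
    -- position.
    fun a ha b hb => List.Pairwise.forall_of_forall_of_flip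
      (R := fun a b : Raw × Raw => a.1 = b.1 → a = b) (fun _ _ _ => rfl)
      (hs.imp fun h h' => absurd (h' ▸ h) (irrefl _))
      (hs.imp fun h h' => absurd (h' ▸ h) (irrefl _)) ha hb
  intro e he e' he' h
  have := hinj _ ((hm _).2 ⟨e, he, rfl⟩) _ ((hm _).2 ⟨e', he', rfl⟩) (congrArg Subtype.val h)
  exact Prod.ext h (Subtype.ext (congrArg Prod.snd this))

theorem ETy.parse_array_eq_some {a : EAGroup} {x : Cbor} {v : a.Interp} :
    (ETy.array a).parse x = some v ↔ ∃ l, x.asArray = some l ∧ a.parse l = some (v, []) := by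
  unfold ETy.parse
  cases x.asArray with
  | none => exact ⟨(fun h => nomatch h), (fun ⟨_, h, _⟩ => nomatch h)⟩
  | some l =>
    dsimp only
    rcases hl : a.parse l with _ | ⟨w, _ | _⟩
    · exact ⟨(fun h => nomatch h), fun ⟨l', h, h'⟩ => by
        cases h
        exact nomatch hl.symm.trans h'⟩
    · constructor
      · intro h
        cases Option.some_injective _ h
        exact ⟨l, rfl, hl⟩
      · rintro ⟨_, ⟨⟩, h⟩
        cases Option.some_injective _ (hl.symm.trans h)
        rfl
    · exact ⟨(fun h => nomatch h), fun ⟨l', h, h'⟩ => by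
        cases h
        exact nomatch hl.symm.trans h'⟩

theorem ETy.parse_map_eq_some {g : EMGroup} {x : Cbor} {v : g.Interp} :
    (ETy.map g).parse x = some v ↔ ∃ m, x.asMap = some m ∧ g.parse m = .ok (v, ∅) := by
  unfold ETy.parse
  cases x.asMap with
  | none => exact ⟨(fun h => nomatch h), (fun ⟨_, h, _⟩ => nomatch h)⟩
  | some m =>
    dsimp only
    rcases hm : g.parse m with _ | _ | ⟨w, r⟩
    · exact ⟨(fun h => nomatch h), fun ⟨m', h, h'⟩ => by
        cases h
        exact nomatch hm.symm.trans h'⟩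
    · exact ⟨(fun h => nomatch h), fun ⟨m', h, h'⟩ => by
        cases h
        exact nomatch hm.symm.trans h'⟩
    · dsimp only
      constructor
      · intro h
        split_ifs at h with hr
        cases Option.some_injective _ h
        exact ⟨m, rfl, hr ▸ hm⟩
      · rintro ⟨_, ⟨⟩, h⟩
        cases hm.symm.trans h
        exact if_pos rfl

theorem AFaithful.array {a : EAGroup} (h : AFaithful a.sem a.parse) :
    Faithful (ETy.array a).Valid (ETy.array a).parse := by
  obtain ⟨f, h⟩ := h
  unfold ETy.Valid
  refine .of_injective (fun x hx => ?_) (fun x v hx => ?_) (fun x y v hx hy => ?_)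
  · obtain ⟨l, hx, c, hl⟩ := hx
    rw [(h l).1] at hl
    obtain ⟨⟨v, r⟩, hv, hr⟩ := Option.map_eq_some_iff.1 hl
    cases hr
    exact ⟨v, ETy.parse_array_eq_some.2 ⟨l, hx, hv⟩⟩
  · obtain ⟨l, hx, hl⟩ := ETy.parse_array_eq_some.1 hx
    exact ⟨l, hx, f v, by rw [(h l).1, hl]; rfl⟩
  · obtain ⟨l, hx, hl⟩ := ETy.parse_array_eq_some.1 hx
    obtain ⟨l', hy, hl'⟩ := ETy.parse_array_eq_some.1 hy
    have hll' : l = l' := ((h _).2 _ _ hl).trans ((h _).2 _ _ hl').symm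
    exact Subtype.ext ((Cbor.asArray_eq_some hx).trans
      (hll' ▸ (Cbor.asArray_eq_some hy).symm))

/-- The three outcomes of the parser are exhaustive, so the one-way implications of `MFaithful`
suffice: a failed cut and an empty result set exclude validity, and a singleton result consumes
everything exactly when its rest is empty. -/
theorem MFaithful.map {g : EMGroup} (h : MFaithful g.sem g.parse) :
    Faithful (ETy.map g).Valid (ETy.map g).parse := by
  obtain ⟨f, h⟩ := h
  unfold ETy.Valid
  refine .of_injective (fun x hx => ?_) (fun x v hx => ?_) (fun x y v hx hy => ?_)
  · obtain ⟨m, hx, S, hS, c, hc⟩ := hx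
    obtain ⟨h1, h2, h3⟩ := h m (Cbor.asMap_isMap hx)
    rcases hm : g.parse m with _ | _ | ⟨v, r⟩
    · simp [h1 hm] at hS
    · simp only [h2 hm, Option.some.injEq] at hS
      simp [← hS] at hc
    · simp only [(h3 _ _ hm).1, Option.some.injEq] at hS
      obtain ⟨-, rfl⟩ : _ ∧ ∅ = r := by simpa [← hS] using hc
      exact ⟨v, ETy.parse_map_eq_some.2 ⟨m, hx, hm⟩⟩
  · obtain ⟨m, hx, hm⟩ := ETy.parse_map_eq_some.1 hx
    exact ⟨m, hx, _, ((h m (Cbor.asMap_isMap hx)).2.2 _ _ hm).1, f v, rfl⟩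
  · obtain ⟨m, hx, hm⟩ := ETy.parse_map_eq_some.1 hx
    obtain ⟨m', hy, hm'⟩ := ETy.parse_map_eq_some.1 hy
    have : m = m' := ((h _ (Cbor.asMap_isMap hx)).2.2 _ _ hm).2.trans
      ((h _ (Cbor.asMap_isMap hy)).2.2 _ _ hm').2.symm
    subst this
    exact Cbor.asMap_inj hx hy

/-- The injection in the value tells which reconstruction to apply. The second parser is reached
only when `V₁` fails, and there the disjunction reduces to `V₂`. -/
theorem Faithful.alt {α β : Type} {V₁ V₂ : Cbor → Prop} {p₁ : Cbor → Option α}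
    {p₂ : Cbor → Option β} (h₁ : Faithful V₁ p₁) (h₂ : Faithful V₂ p₂) :
    Faithful (fun x => V₁ x ∨ V₂ x)
      (fun x => if V₁ x then (p₁ x).map Sum.inl else (p₂ x).map Sum.inr) := by
  obtain ⟨hV₁, f₁, hf₁⟩ := h₁
  obtain ⟨hV₂, f₂, hf₂⟩ := h₂
  refine ⟨fun x => ?_, Sum.elim f₁ f₂, fun x v h => ?_⟩
  · by_cases hx : V₁ x
    · simpa [hx] using (hV₁ x).1 hx
    · simpa [hx] using hV₂ x
  · dsimp only at h
    split_ifs at h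
    · obtain ⟨w, hw, rfl⟩ := Option.map_eq_some_iff.1 h
      exact hf₁ x w hw
    · obtain ⟨w, hw, rfl⟩ := Option.map_eq_some_iff.1 h
      exact hf₂ x w hw

-- Faithfulness of all elaborated types, by mutual induction

mutual

theorem ETy.faithful : ∀ t : ETy, Faithful t.Valid t.parse
  | .base b => by
    -- The carriers `b.Interp` and `(ETy.base b).Interp` agree by unfolding, which the final `exact`
    -- checks; the other cases follow the same pattern.
    have := b.faithful
    unfold ETy.Valid ETy.parse
    exact this
  | .array a => a.faithful.array
  | .map g => g.faithful.map
  | .alt t₁ t₂ => by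
    have := Faithful.alt t₁.faithful t₂.faithful
    unfold ETy.Valid ETy.parse
    exact this

theorem EAGroup.faithful : ∀ a : EAGroup, AFaithful a.sem a.parse
  | .item t => by
    have := AFaithful.item t.faithful
    unfold EAGroup.sem EAGroup.parse
    exact this
  | .choice a₁ a₂ => by
    have := AFaithful.choice a₁.faithful a₂.faithful
    unfold EAGroup.sem EAGroup.parse
    exact this
  | .opt a => by
    have := AFaithful.opt a.faithful
    unfold EAGroup.sem EAGroup.parse
    exact this
  | .seq a₁ a₂ => by
    have := AFaithful.seq a₁.faithful a₂.faithful
    unfold EAGroup.sem EAGroup.parse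
    exact this
  | .star a => by
    have := AFaithful.star a.faithful
    unfold EAGroup.sem EAGroup.parse
    exact this

theorem EMGroup.faithful : ∀ g : EMGroup, MFaithful g.sem g.parse
  | .entry l t => by
    have := MFaithful.entry l t.faithful
    unfold EMGroup.sem EMGroup.parse
    exact this
  | .cutEntry l t => by
    have := MFaithful.cutEntry l t.faithful
    unfold EMGroup.sem EMGroup.parse
    exact this
  | .table k rej t => by
    have := MFaithful.table (R := rej.Valid) k.faithful t.faithful
    unfold EMGroup.sem EMGroup.parse
    exact this
  | .choice g₁ g₂ => by
    have := MFaithful.choice g₁.faithful g₂.faithful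
    unfold EMGroup.sem EMGroup.parse
    exact this
  | .opt g => by
    have := MFaithful.opt g.faithful
    unfold EMGroup.sem EMGroup.parse
    exact this
  | .seq g₁ g₂ => by
    have := MFaithful.seq g₁.faithful g₂.faithful
    unfold EMGroup.sem EMGroup.parse
    exact this

end

-- Repeated choices of entries as tables

/-- Each result of the group is the consumption of a single entry in `E`, and it matches if there
is one. -/
def MSem.Picks (g : MSem) (E : Cbor × Cbor → Prop) : Prop :=
  ∀ m, ∃ S, g m = some S ∧ (S = ∅ → ∀ e ∈ m, ¬ E e) ∧
    ∀ cr ∈ S, ∃ e ∈ m, E e ∧ cr = ({e}, m.erase e)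

namespace MSem

theorem Picks.entry (P Q : Cbor → Prop) : (MSem.entry P Q).Picks (fun e => P e.1 ∧ Q e.2) := by
  refine fun m => ⟨_, rfl, fun h e he hE => ?_, ?_⟩
  · exact Set.notMem_empty _ (h ▸ ⟨e, he, hE.1, hE.2, rfl⟩ :
      (({e}, m.erase e) : Entries × Entries) ∈ (∅ : Set _))
  · rintro cr ⟨e, he, hP, hQ, rfl⟩
    exact ⟨e, he, ⟨hP, hQ⟩, rfl⟩

/-- No cut can fail here. The priority of the left alternative affects only which entry is picked,
not whether some pick exists. -/
theorem Picks.choice {g₁ g₂ : MSem} {E₁ E₂ : Cbor × Cbor → Prop} (h₁ : g₁.Picks E₁)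
    (h₂ : g₂.Picks E₂) : (MSem.choice g₁ g₂).Picks (fun e => E₁ e ∨ E₂ e) := by
  intro m
  obtain ⟨S₁, hS₁, hn₁, hE₁⟩ := h₁ m
  obtain ⟨S₂, hS₂, hn₂, hE₂⟩ := h₂ m
  unfold MSem.choice
  simp only [hS₁, hS₂]
  split_ifs with h
  · refine ⟨S₂, rfl, fun h' e he hE => hE.elim (hn₁ h e he) (hn₂ h' e he), fun cr hcr => ?_⟩
    obtain ⟨e, he, hE, rfl⟩ := hE₂ cr hcr
    exact ⟨e, he, .inr hE, rfl⟩
  · refine ⟨S₁, rfl, fun h' => (h h').elim, fun cr hcr => ?_⟩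
    obtain ⟨e, he, hE, rfl⟩ := hE₁ cr hcr
    exact ⟨e, he, .inl hE, rfl⟩

/-- Each iteration removes one entry in `E`, and the repetition stops only when none is left. All
runs therefore end with the same pair, and the nondeterminism disappears; the cardinality of the map
is enough fuel. -/
theorem Picks.starUpTo {g : MSem} {E : Cbor × Cbor → Prop} (h : g.Picks E) (n : ℕ) (m : Entries)
    (hm : m.card ≤ n) : g.starUpTo n m = MSem.filter E m := by
  induction n generalizing m with
  | zero =>
    cases Finset.card_eq_zero.1 (Nat.le_zero.1 hm)
    simp [MSem.starUpTo, MSem.filter]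
  | succ n ih =>
    obtain ⟨S, hS, hn, hE⟩ := h m
    simp only [MSem.starUpTo, hS]
    split_ifs with h0
    · have := hn h0
      simp only [MSem.filter, Finset.filter_false_of_mem this, Finset.filter_true_of_mem this]
    -- A pick consumes a nonempty set, so the test for lack of progress never fires and the
    -- induction hypothesis applies to the smaller rest.
    · have key : ∀ cr ∈ S, (if cr.1 = ∅ then some {(∅, cr.2)} else g.starUpTo n cr.2) =
          MSem.filter E cr.2 := by
        intro cr hcr
        obtain ⟨e, he, -, rfl⟩ := hE cr hcr
        rw [if_neg (Finset.singleton_ne_empty e)]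
        exact ih _ (by have := Finset.card_erase_lt_of_mem he; dsimp only; omega)
      unfold MSem.extend
      rw [if_neg]
      · refine congrArg some (Set.ext fun x => ?_)
        -- Whatever entry is picked first, adding it back to what is later consumed gives the same
        -- total and the same rest.
        have step : ∀ cr ∈ S, cr.1 ∪ Finset.filter E cr.2 = Finset.filter E m ∧
            Finset.filter (fun e => ¬ E e) cr.2 = Finset.filter (fun e => ¬ E e) m := by
          intro cr hcr
          obtain ⟨e, he, hEe, rfl⟩ := hE cr hcr
          constructor <;> ext e' <;> by_cases h : e' = e <;> simp_all
        constructor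
        · rintro ⟨cr, hcr, T, hT, cr₂, hcr₂, rfl⟩
          dsimp only at hT
          rw [key cr hcr] at hT
          cases hT
          cases hcr₂
          exact Prod.ext (step cr hcr).1 (step cr hcr).2
        · rintro rfl
          obtain ⟨cr, hcr⟩ := Set.nonempty_iff_ne_empty.2 h0
          exact ⟨cr, hcr, _, key cr hcr, _, rfl,
            Prod.ext (step cr hcr).1.symm (step cr hcr).2.symm⟩
      · rintro ⟨cr, hcr, hk⟩
        dsimp only at hk
        rw [key cr hcr] at hk
        exact nomatch hk

theorem Picks.star {g : MSem} {E : Cbor × Cbor → Prop} (h : g.Picks E) :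
    g.star = MSem.filter E :=
  funext fun m => h.starUpTo m.card m le_rfl

/-- The second filter sees only entries outside `E₁`; joined with the first, it still accounts for
all of `E₂`, so overlap does no harm. -/
theorem seq_filter (E₁ E₂ : Cbor × Cbor → Prop) :
    MSem.seq (MSem.filter E₁) (MSem.filter E₂) = MSem.filter (fun e => E₁ e ∨ E₂ e) := by
  funext m
  simp only [MSem.seq, MSem.filter, MSem.extend_singleton, Option.map_some, Set.mem_singleton_iff,
    exists_eq_left, Set.ofPred_eq_eq_singleton]
  congr 3
  · ext e
    by_cases h : E₁ e <;> simp [h]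
  · ext e
    by_cases h : E₁ e <;> simp [h]

end MSem

-- Canonicalization preserves the semantics

mutual

theorem Ty.canonical_valid : ∀ (t : Ty) {c : ETy}, t.canonical = some c → t.Valid = c.Valid
  | .base b, c, h => by
    simp only [Ty.canonical, Option.some.injEq] at h
    subst h
    simp only [Ty.Valid, ETy.Valid]
  | .array a, c, h => by
    simp only [Ty.canonical, Option.bind_eq_bind, Option.bind_eq_some_iff, Option.pure_def,
      Option.some.injEq] at h
    obtain ⟨a', ha, rfl⟩ := h
    simp only [Ty.Valid, ETy.Valid, a.canonical_sem ha]
  | .map g, c, h => by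
    simp only [Ty.canonical, Option.bind_eq_bind, Option.bind_eq_some_iff, Option.pure_def,
      Option.some.injEq] at h
    obtain ⟨g', hg, rfl⟩ := h
    simp only [Ty.Valid, ETy.Valid, g.canonical_sem hg]
  | .alt t₁ t₂, c, h => by
    simp only [Ty.canonical, Option.bind_eq_bind, Option.bind_eq_some_iff, Option.pure_def,
      Option.some.injEq] at h
    obtain ⟨t₁', h₁, t₂', h₂, rfl⟩ := h
    simp only [Ty.Valid, ETy.Valid, t₁.canonical_valid h₁, t₂.canonical_valid h₂]

theorem AGroup.canonical_sem : ∀ (a : AGroup) {c : EAGroup}, a.canonical = some c → a.sem = c.sem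
  | .item t, c, h => by
    simp only [AGroup.canonical, Option.bind_eq_bind, Option.bind_eq_some_iff, Option.pure_def,
      Option.some.injEq] at h
    obtain ⟨t', ht, rfl⟩ := h
    simp only [AGroup.sem, EAGroup.sem, t.canonical_valid ht]
  | .choice a₁ a₂, c, h => by
    simp only [AGroup.canonical, Option.bind_eq_bind, Option.bind_eq_some_iff, Option.pure_def,
      Option.some.injEq] at h
    obtain ⟨a₁', h₁, a₂', h₂, rfl⟩ := h
    simp only [AGroup.sem, EAGroup.sem, a₁.canonical_sem h₁, a₂.canonical_sem h₂]
  | .opt a, c, h => by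
    simp only [AGroup.canonical, Option.bind_eq_bind, Option.bind_eq_some_iff, Option.pure_def,
      Option.some.injEq] at h
    obtain ⟨a', ha, rfl⟩ := h
    simp only [AGroup.sem, EAGroup.sem, a.canonical_sem ha]
  | .seq a₁ a₂, c, h => by
    simp only [AGroup.canonical, Option.bind_eq_bind, Option.bind_eq_some_iff, Option.pure_def,
      Option.some.injEq] at h
    obtain ⟨a₁', h₁, a₂', h₂, rfl⟩ := h
    simp only [AGroup.sem, EAGroup.sem, a₁.canonical_sem h₁, a₂.canonical_sem h₂]
  | .star a, c, h => by
    simp only [AGroup.canonical, Option.bind_eq_bind, Option.bind_eq_some_iff, Option.pure_def,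
      Option.some.injEq] at h
    obtain ⟨a', ha, rfl⟩ := h
    simp only [AGroup.sem, EAGroup.sem, a.canonical_sem ha]

theorem MGroup.canonical_sem : ∀ (g : MGroup) {c : EMGroup}, g.canonical = some c → g.sem = c.sem
  | .entry k t, c, h => by
    unfold MGroup.canonical at h
    split at h
    · rename_i l t' heq
      cases heq
      simp only [Option.bind_eq_bind, Option.bind_eq_some_iff, Option.pure_def,
        Option.some.injEq] at h
      obtain ⟨t', ht, rfl⟩ := h
      simp only [MGroup.sem, EMGroup.sem, t.canonical_valid ht, Ty.Valid]
      rfl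
    -- A key that is not a literal has no canonical form.
    all_goals simp_all
  | .cutEntry l t, c, h => by
    simp only [MGroup.canonical, Option.bind_eq_bind, Option.bind_eq_some_iff, Option.pure_def,
      Option.some.injEq] at h
    obtain ⟨t', ht, rfl⟩ := h
    simp only [MGroup.sem, EMGroup.sem, t.canonical_valid ht]
  | .choice g₁ g₂, c, h => by
    simp only [MGroup.canonical, Option.bind_eq_bind, Option.bind_eq_some_iff, Option.pure_def,
      Option.some.injEq] at h
    obtain ⟨g₁', h₁, g₂', h₂, rfl⟩ := h
    simp only [MGroup.sem, EMGroup.sem, g₁.canonical_sem h₁, g₂.canonical_sem h₂]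
  | .opt g, c, h => by
    simp only [MGroup.canonical, Option.bind_eq_bind, Option.bind_eq_some_iff, Option.pure_def,
      Option.some.injEq] at h
    obtain ⟨g', hg, rfl⟩ := h
    simp only [MGroup.sem, EMGroup.sem, g.canonical_sem hg]
  | .seq g₁ g₂, c, h => by
    simp only [MGroup.canonical, Option.bind_eq_bind, Option.bind_eq_some_iff, Option.pure_def,
      Option.some.injEq] at h
    obtain ⟨g₁', h₁, g₂', h₂, rfl⟩ := h
    simp only [MGroup.sem, EMGroup.sem, g₁.canonical_sem h₁, g₂.canonical_sem h₂]
  | .star g, c, h => by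
    simp only [MGroup.canonical] at h
    obtain ⟨E, hg, hc⟩ := g.starCanonical_sem h
    simp only [MGroup.sem, hc, hg.star]

/-- The predicate `E` links the two sides: one iteration of `g` picks from it, and the tables
replacing the repetition filter by it. For an entry the excluded keys are those of `⊥`, so no key is
excluded. -/
theorem MGroup.starCanonical_sem : ∀ (g : MGroup) {c : EMGroup}, g.starCanonical = some c →
    ∃ E, g.sem.Picks E ∧ c.sem = MSem.filter E
  | .entry k t, c, h => by
    simp only [MGroup.starCanonical, Option.bind_eq_bind, Option.bind_eq_some_iff, Option.pure_def,
      Option.some.injEq] at h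
    obtain ⟨k', hk, t', ht, rfl⟩ := h
    refine ⟨fun e => k.Valid e.1 ∧ t.Valid e.2, ?_, ?_⟩
    · simpa only [MGroup.sem] using MSem.Picks.entry _ _
    · simp only [EMGroup.sem, MSem.table_eq, ETy.Valid, k.canonical_valid hk, t.canonical_valid ht,
        Base.Valid, not_false_eq_true, true_and]
  | .choice g₁ g₂, c, h => by
    simp only [MGroup.starCanonical, Option.bind_eq_bind, Option.bind_eq_some_iff, Option.pure_def,
      Option.some.injEq] at h
    obtain ⟨g₁', h₁, g₂', h₂, rfl⟩ := h
    obtain ⟨E₁, hg₁, hc₁⟩ := g₁.starCanonical_sem h₁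
    obtain ⟨E₂, hg₂, hc₂⟩ := g₂.starCanonical_sem h₂
    refine ⟨fun e => E₁ e ∨ E₂ e, ?_, ?_⟩
    · simpa only [MGroup.sem] using hg₁.choice hg₂
    · simp only [EMGroup.sem, hc₁, hc₂, MSem.seq_filter]
  | .cutEntry _ _, _, h | .opt _, _, h | .seq _ _, _, h | .star _, _, h => by
    simp [MGroup.starCanonical] at h

end

end CDDL

-- The theorem

theorem theorem7 (t : CDDL.Ty) (t' : CDDL.ETy) (h : t.elaborate = some t') :
    CDDL.Unambiguous t.Valid t.parse ∧ CDDL.Unambiguous t'.Valid t'.parse := by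
  refine ⟨?_, t'.faithful.unambiguous⟩
  unfold CDDL.Ty.elaborate at h
  -- Elaboration passes through a canonical form `c`, by which the parser of `t` is defined.
  obtain ⟨c, hc, -⟩ := Option.bind_eq_some_iff.1 h
  rw [t.canonical_valid hc]
  unfold CDDL.Ty.parse CDDL.Ty.Interp
  rw [hc]
  exact c.faithful.unambiguous
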